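/- Let $\gamma$ be Euler's constant and let $G$ be the Barnes $G$-function, defined by the Weierstrass canonical product $$G(1+x) = (2\pi)^{x/2}\exp\left[-\tfrac12(\gamma x^2+x^2+x)\right]\prod_{k=1}^{\infty}\left\{\left(1+\frac{x}{k}\right)^k\exp\left(\frac{x^2}{2k}-x\right)\right\}.$$ For every real $t>0$ the product defining $G(1+t)$ converges, $G(1+t)>0$, the integral below converges absolutely, and $$\log G(1+t) = t\log\Gamma(t)+\frac14(t^2-1)-\frac12t(t-1)\log t+\int_0^\infty\frac{e^{-tv}-e^{-v}}{v^2}\left[\frac{1}{e^v-1}-\frac1v+\frac12\right]dv.$$ -/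

import Mathlib

/-- The `k`-th factor (`k ≥ 1`) of the Weierstrass product of `G (1 + x)`, namely
`(1 + x / k) ^ k * exp (x ^ 2 / (2 k) - x)`. -/
noncomputable def barnesGFactor (x : ℝ) (k : ℕ) : ℝ :=
  (1 + x / (k : ℝ)) ^ k * Real.exp (x ^ 2 / (2 * (k : ℝ)) - x)

/-- The Barnes `G`-function on the real line, through its Weierstrass canonical product:
with `x = y - 1`,
`G (1 + x) = (2 π) ^ (x / 2) * exp (-(γ x ^ 2 + x ^ 2 + x) / 2) * ∏_{k ≥ 1} barnesGFactor x k`,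
the product being indexed by `k = n + 1`, `n = 0, 1, 2, …`. -/
noncomputable def barnesG (y : ℝ) : ℝ :=
  (2 * Real.pi) ^ ((y - 1) / 2)
    * Real.exp (-(1 / 2) *
        (Real.eulerMascheroniConstant * (y - 1) ^ 2 + (y - 1) ^ 2 + (y - 1)))
    * ∏' n : ℕ, barnesGFactor (y - 1) (n + 1)

open Filter Topology MeasureTheory Set

/-! Write `I(a, b)` for the integral of `binetIntegrand a b`. A unit shift `I(t+1, t)` is elementary
by Fubini (`integral_binetIntegrand_succ`), hence so is `I(t+N, t)` by telescoping. Since `I(t+N,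
1+N) → 0`, `I(t, 1)` is the limit of `I(1+N, 1) - I(t+N, t)` (`tendsto_binet_partial`). Truncating
the Weierstrass product and Euler's limit for `log Γ` at the same `N`, all sums of logarithms cancel
except `log N!` (`truncated_sum_eq`). Stirling's formula absorbs `log N!` and `log (2π)`, the
harmonic sum absorbs `γ`, and the remaining error terms vanish. -/

/-- The kernel `1 / (e ^ v - 1) - 1 / v + 1 / 2` of Binet's formula. -/
noncomputable def binetKernel (v : ℝ) : ℝ := 1 / (Real.exp v - 1) - 1 / v + 1 / 2

/-- The difference of two exponentials integrated against `binetKernel v / v ^ 2`. -/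
noncomputable def binetIntegrand (a b v : ℝ) : ℝ :=
  (Real.exp (-a * v) - Real.exp (-b * v)) / v ^ 2 * binetKernel v

/-! ### Bounds for the kernel and absolute convergence. -/

lemma binetKernel_nonneg {v : ℝ} (hv : 0 < v) : 0 ≤ binetKernel v := by
  -- The numerator of the kernel over the denominator `2v(e^v - 1)`; it vanishes at `0`.
  have hmono : MonotoneOn (fun x : ℝ => (x - 2) * Real.exp x + x + 2) (Ici 0) := by
    have hd : ∀ x : ℝ, HasDerivAt (fun x : ℝ => (x - 2) * Real.exp x + x + 2)
        ((x - 1) * Real.exp x + 1) x := fun x => by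
      have := ((((hasDerivAt_id x).sub_const 2).mul (Real.hasDerivAt_exp x)).add
        (hasDerivAt_id x)).add_const 2
      refine this.congr_deriv ?_
      simp only [id]
      ring
    refine monotoneOn_of_deriv_nonneg (convex_Ici 0)
      (fun x _ => (hd x).continuousAt.continuousWithinAt)
      (fun x _ => (hd x).differentiableAt.differentiableWithinAt) fun x _ => ?_
    rw [(hd x).deriv]
    have h1 := Real.add_one_le_exp (-x)
    have h2 : Real.exp (-x) * Real.exp x = 1 := by rw [← Real.exp_add]; simp
    nlinarith [Real.exp_pos x]
  have h := hmono (mem_Ici.2 le_rfl) (mem_Ici.2 hv.le) hv.le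
  simp only [Real.exp_zero] at h
  have he : 0 < Real.exp v - 1 := by linarith [Real.add_one_lt_exp hv.ne']
  have : binetKernel v
      = ((v - 2) * Real.exp v + v + 2) / (2 * v * (Real.exp v - 1)) := by
    unfold binetKernel; field_simp; ring
  rw [this]
  exact div_nonneg (by linarith) (by positivity)

/-- This factor `v`, with the one in `abs_exp_sub_exp_le`, cancels the `1 / v ^ 2` of the integrand.
-/
lemma binetKernel_le {v : ℝ} (hv : 0 < v) : binetKernel v ≤ v / 4 := by
  have h := Real.quadratic_le_exp_of_nonneg hv.le
  have h1 : 1 / (Real.exp v - 1) ≤ 1 / (v + v ^ 2 / 2) :=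
    one_div_le_one_div_of_le (by positivity) (by linarith)
  have h2 : v / 4 - (1 / (v + v ^ 2 / 2) - 1 / v + 1 / 2) = v ^ 2 / (4 * (2 + v)) := by
    field_simp; ring
  have h3 : 0 ≤ v ^ 2 / (4 * (2 + v)) := by positivity
  unfold binetKernel
  linarith

lemma abs_exp_sub_exp_le {a b m v : ℝ} (ha : m ≤ a) (hb : m ≤ b) (hv : 0 ≤ v) :
    |Real.exp (-a * v) - Real.exp (-b * v)| ≤ |a - b| * v * Real.exp (-m * v) := by
  wlog hab : a ≤ b generalizing a b
  · rw [abs_sub_comm, abs_sub_comm a b]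
    exact this hb ha (le_of_not_ge hab)
  have h1 : Real.exp (-b * v) = Real.exp (-a * v) * Real.exp (-((b - a) * v)) := by
    rw [← Real.exp_add]; ring_nf
  have h2 := Real.add_one_le_exp (-((b - a) * v))
  have h0 : 0 ≤ (b - a) * v := mul_nonneg (by linarith) hv
  have h3 : Real.exp (-((b - a) * v)) ≤ 1 := Real.exp_le_one_iff.2 (by linarith)
  have h4 : Real.exp (-a * v) ≤ Real.exp (-m * v) := Real.exp_le_exp.2 (by nlinarith)
  have h5 := Real.exp_pos (-a * v)
  rw [abs_sub_comm a b, abs_of_nonneg (by linarith : 0 ≤ b - a), h1, abs_of_nonneg (by nlinarith)]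
  calc _ = Real.exp (-a * v) * (1 - Real.exp (-((b - a) * v))) := by ring
    _ ≤ Real.exp (-a * v) * ((b - a) * v) := by gcongr; linarith
    _ ≤ Real.exp (-m * v) * ((b - a) * v) := by gcongr
    _ = _ := by ring

lemma norm_binetIntegrand_le {a b m v : ℝ} (ha : m ≤ a) (hb : m ≤ b) (hv : 0 < v) :
    ‖binetIntegrand a b v‖ ≤ |a - b| / 4 * Real.exp (-m * v) := by
  have h1 := abs_exp_sub_exp_le ha hb hv.le
  rw [binetIntegrand, Real.norm_eq_abs, abs_mul, abs_div, abs_of_nonneg (binetKernel_nonneg hv),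
    abs_of_pos (by positivity : 0 < v ^ 2)]
  calc _ ≤ |a - b| * v * Real.exp (-m * v) / v ^ 2 * (v / 4) := by
        gcongr
        exacts [binetKernel_nonneg hv, binetKernel_le hv]
    _ = _ := by field_simp

lemma integrableOn_binetIntegrand {a b : ℝ} (ha : 0 < a) (hb : 0 < b) :
    IntegrableOn (binetIntegrand a b) (Ioi 0) := by
  have hm : 0 < min a b := lt_min ha hb
  refine Integrable.mono' ((integrableOn_exp_mul_Ioi (neg_lt_zero.2 hm) 0).const_mul (|a - b| / 4))
    (Measurable.aestronglyMeasurable (by unfold binetIntegrand binetKernel; fun_prop)) ?_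
  filter_upwards [ae_restrict_mem measurableSet_Ioi] with v hv
  exact norm_binetIntegrand_le (min_le_left _ _) (min_le_right _ _) hv

lemma abs_integral_binetIntegrand_le {a b m : ℝ} (hm : 0 < m) (ha : m ≤ a) (hb : m ≤ b) :
    |∫ v in Ioi 0, binetIntegrand a b v| ≤ |a - b| / 4 * (1 / m) := by
  have h := norm_integral_le_of_norm_le
    ((integrableOn_exp_mul_Ioi (neg_lt_zero.2 hm) 0).const_mul (|a - b| / 4))
    (f := binetIntegrand a b) (by
      filter_upwards [ae_restrict_mem measurableSet_Ioi] with v hv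
      exact norm_binetIntegrand_le ha hb hv)
  rw [integral_const_mul, integral_exp_mul_Ioi (neg_lt_zero.2 hm) 0] at h
  simpa using h

lemma integral_binetIntegrand_add {a b c : ℝ} (ha : 0 < a) (hb : 0 < b) (hc : 0 < c) :
    (∫ v in Ioi 0, binetIntegrand a b v) + ∫ v in Ioi 0, binetIntegrand b c v
      = ∫ v in Ioi 0, binetIntegrand a c v := by
  rw [← integral_add (integrableOn_binetIntegrand ha hb) (integrableOn_binetIntegrand hb hc)]
  congr 1; ext v; unfold binetIntegrand; ring

/-! ### Integer shifts of the parameter. -/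

lemma integral_quadratic_mul_exp {v : ℝ} (hv : 0 < v) :
    ∫ s in (0 : ℝ)..1, s * (s - 1) / 2 * Real.exp (-s * v)
      = (Real.exp (-v) - 1) / v ^ 2 * binetKernel v := by
  have hd : ∀ s ∈ uIcc (0 : ℝ) 1, HasDerivAt
      (fun s : ℝ => -(s * (s - 1) / 2 / v + (s - 1 / 2) / v ^ 2 + 1 / v ^ 3) * Real.exp (-s * v))
      (s * (s - 1) / 2 * Real.exp (-s * v)) s := fun s _ => by
    have hi := hasDerivAt_id s
    have h1 := (((((hi.mul (hi.sub_const 1)).div_const 2).div_const v).add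
      ((hi.sub_const (1 / 2)).div_const (v ^ 2))).add_const (1 / v ^ 3)).neg.mul
      ((hi.neg.mul_const v).exp)
    refine h1.congr_deriv ?_
    simp only [id, Pi.mul_apply, Pi.neg_apply, Pi.add_apply]
    field_simp; ring
  rw [intervalIntegral.integral_eq_sub_of_hasDerivAt hd
    (Continuous.intervalIntegrable (by fun_prop) _ _)]
  have he : 0 < Real.exp v - 1 := by linarith [Real.add_one_lt_exp hv.ne']
  have hn : Real.exp (-v) = 1 / Real.exp v := by rw [Real.exp_neg]; simp
  have := Real.exp_pos v
  simp only [neg_mul, one_mul, neg_zero, zero_mul, Real.exp_zero, hn, binetKernel]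
  field_simp
  ring

lemma integral_quadratic_div_add {t : ℝ} (ht : 0 < t) :
    ∫ s in (0 : ℝ)..1, s * (s - 1) / 2 * (1 / (t + s))
      = t * (t + 1) / 2 * (Real.log (t + 1) - Real.log t) - (2 * t + 1) / 4 := by
  have hp : ∀ s ∈ uIcc (0 : ℝ) 1, 0 < t + s := fun s hs => by
    rw [uIcc_of_le zero_le_one] at hs; linarith [hs.1]
  have hd : ∀ s ∈ uIcc (0 : ℝ) 1, HasDerivAt
      (fun s : ℝ => (s ^ 2 / 2 - (1 + t) * s + t * (t + 1) * Real.log (t + s)) / 2)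
      (s * (s - 1) / 2 * (1 / (t + s))) s := fun s hs => by
    have hi := hasDerivAt_id s
    have h1 := (((((hasDerivAt_pow 2 s).div_const 2).sub (hi.const_mul (1 + t))).add
      (((hi.const_add t).log (hp s hs).ne').const_mul (t * (t + 1))))).div_const 2
    refine h1.congr_deriv ?_
    simp only [id]
    have := hp s hs
    field_simp
    push_cast; ring
  rw [intervalIntegral.integral_eq_sub_of_hasDerivAt hd]
  · simp only [add_zero]; ring
  · refine ContinuousOn.intervalIntegrable (ContinuousOn.mul (by fun_prop) ?_)
    exact ContinuousOn.div (by fun_prop) (by fun_prop) fun s hs => (hp s hs).ne'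

lemma integral_binetIntegrand_succ {t : ℝ} (ht : 0 < t) :
    ∫ v in Ioi 0, binetIntegrand (t + 1) t v
      = t * (t + 1) / 2 * (Real.log (t + 1) - Real.log t) - (2 * t + 1) / 4 := by
  have hint : Integrable (Function.uncurry fun (v s : ℝ) =>
      Real.exp (-t * v) * (s * (s - 1) / 2 * Real.exp (-s * v)))
      ((volume.restrict (Ioi 0)).prod (volume.restrict (Ioc 0 1))) := by
    have h1 : Integrable (fun v : ℝ => Real.exp (-t * v)) (volume.restrict (Ioi 0)) :=
      integrableOn_exp_mul_Ioi (neg_lt_zero.2 ht) 0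
    have h2 : Integrable (fun _ : ℝ => (1 : ℝ)) (volume.restrict (Ioc (0 : ℝ) 1)) :=
      integrable_const _
    refine (h1.mul_prod h2).mono' (Continuous.aestronglyMeasurable (by fun_prop)) ?_
    rw [Measure.prod_restrict]
    filter_upwards [ae_restrict_mem (measurableSet_Ioi.prod measurableSet_Ioc)] with p hp
    obtain ⟨hv, hs0, hs1⟩ := hp
    simp only [mem_Ioi] at hv
    have he : Real.exp (-p.2 * p.1) ≤ 1 := Real.exp_le_one_iff.2 (by nlinarith)
    have hq : |p.2 * (p.2 - 1) / 2| ≤ 1 := abs_le.2 ⟨by nlinarith, by nlinarith⟩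
    simp only [Function.uncurry, Real.norm_eq_abs, abs_mul, Real.abs_exp]
    gcongr
    exact mul_le_one₀ hq (Real.exp_pos _).le he
  calc ∫ v in Ioi 0, binetIntegrand (t + 1) t v
      = ∫ v in Ioi 0, ∫ s in Ioc (0 : ℝ) 1,
          Real.exp (-t * v) * (s * (s - 1) / 2 * Real.exp (-s * v)) := by
        refine setIntegral_congr_fun measurableSet_Ioi fun v hv => ?_
        rw [integral_const_mul, ← intervalIntegral.integral_of_le zero_le_one,
          integral_quadratic_mul_exp hv, binetIntegrand]
        have : Real.exp (-(t + 1) * v) = Real.exp (-t * v) * Real.exp (-v) := by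
          rw [← Real.exp_add]; ring_nf
        rw [this]; ring
    _ = ∫ s in Ioc (0 : ℝ) 1, ∫ v in Ioi 0,
          Real.exp (-t * v) * (s * (s - 1) / 2 * Real.exp (-s * v)) :=
        integral_integral_swap hint
    _ = ∫ s in Ioc (0 : ℝ) 1, s * (s - 1) / 2 * (1 / (t + s)) := by
        refine setIntegral_congr_fun measurableSet_Ioc fun s hs => ?_
        have hpos : 0 < t + s := by linarith [hs.1]
        have h := integral_exp_mul_Ioi (neg_lt_zero.2 hpos) 0
        have hfun : (fun v : ℝ => Real.exp (-t * v) * (s * (s - 1) / 2 * Real.exp (-s * v)))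
            = fun v => s * (s - 1) / 2 * Real.exp (-(t + s) * v) := by
          ext v
          have : Real.exp (-(t + s) * v) = Real.exp (-t * v) * Real.exp (-s * v) := by
            rw [← Real.exp_add]; ring_nf
          rw [this]; ring
        simp only [hfun, integral_const_mul, h, mul_zero, Real.exp_zero, neg_div_neg_eq]
    _ = _ := by
        rw [← intervalIntegral.integral_of_le zero_le_one, integral_quadratic_div_add ht]

/-- In the telescoped sum, consecutive quadratic weights of `log (t + j)` differ by `t + j`, which
leaves linear weights. -/
lemma integral_binetIntegrand_add_nat {t : ℝ} (ht : 0 < t) (N : ℕ) :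
    ∫ v in Ioi 0, binetIntegrand (t + N) t v
      = (t + N) * (t + N + 1) / 2 * Real.log (t + N) - t * (t + 1) / 2 * Real.log t
        - ∑ j ∈ Finset.range N, (t + (j + 1)) * Real.log (t + (j + 1))
        - (2 * N * t + N ^ 2) / 4 := by
  induction N with
  | zero => simp [binetIntegrand]
  | succ n ih =>
    have hn : 0 < t + n := by positivity
    have h := integral_binetIntegrand_add (a := t + n + 1) (by positivity) hn ht
    rw [ih, integral_binetIntegrand_succ hn] at h
    rw [Finset.sum_range_succ]
    push_cast
    rw [← add_assoc, ← h]
    ring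

lemma tendsto_binet_partial {t : ℝ} (ht : 0 < t) :
    Tendsto (fun N : ℕ => (∫ v in Ioi 0, binetIntegrand (1 + N) 1 v)
      - ∫ v in Ioi 0, binetIntegrand (t + N) t v) atTop
      (𝓝 (∫ v in Ioi 0, binetIntegrand t 1 v)) := by
  have hm : 0 < min t 1 := lt_min ht one_pos
  have h0 : Tendsto (fun N : ℕ => ∫ v in Ioi 0, binetIntegrand (t + N) (1 + N) v) atTop (𝓝 0) := by
    have hb : Tendsto (fun N : ℕ => |t - 1| / 4 * (1 / (min t 1 + N))) atTop (𝓝 0) := by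
      have := (tendsto_const_nhds (x := (1 : ℝ))).div_atTop
        (tendsto_atTop_add_const_left atTop (min t 1) tendsto_natCast_atTop_atTop)
      simpa using this.const_mul (|t - 1| / 4)
    refine squeeze_zero_norm (fun N => ?_) hb
    have := abs_integral_binetIntegrand_le (a := t + N) (b := 1 + N) (m := min t 1 + N)
      (by positivity) (by gcongr; exact min_le_left _ _) (by gcongr; exact min_le_right _ _)
    simpa using this
  have h1 := (tendsto_const_nhds (x := ∫ v in Ioi 0, binetIntegrand t 1 v)).sub h0
  rw [sub_zero] at h1
  refine h1.congr fun N => ?_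
  have hN : 0 < t + (N : ℝ) := by positivity
  have hN1 : 0 < 1 + (N : ℝ) := by positivity
  have e1 := integral_binetIntegrand_add hN hN1 one_pos
  have e2 := integral_binetIntegrand_add hN ht one_pos
  linarith

/-! ### Taylor remainder of the logarithm and convergence of the product. -/

/-- The remainder of the second order Taylor expansion of `log (1 + x)` at `0`. -/
noncomputable def logRemainder (x : ℝ) : ℝ := Real.log (1 + x) - x + x ^ 2 / 2

lemma hasDerivAt_logRemainder {x : ℝ} (hx : 0 ≤ x) :
    HasDerivAt logRemainder (x ^ 2 / (1 + x)) x := by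
  have h1 : (1 + x) ≠ 0 := by positivity
  have := ((((hasDerivAt_id x).const_add 1).log h1).sub (hasDerivAt_id x)).add
    ((hasDerivAt_pow 2 x).div_const 2)
  refine this.congr_deriv ?_
  simp only [id]
  field_simp
  push_cast; ring

lemma logRemainder_nonneg {x : ℝ} (hx : 0 ≤ x) : 0 ≤ logRemainder x := by
  have hm : MonotoneOn logRemainder (Ici 0) := by
    refine monotoneOn_of_hasDerivWithinAt_nonneg (f' := fun x => x ^ 2 / (1 + x)) (convex_Ici 0)
      (fun x hx => (hasDerivAt_logRemainder hx).continuousAt.continuousWithinAt)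
      (fun x hx => (hasDerivAt_logRemainder (interior_subset hx)).hasDerivWithinAt)
      fun x hx => ?_
    have : 0 ≤ x := interior_subset hx
    positivity
  simpa [logRemainder] using hm (mem_Ici.2 le_rfl) hx hx

lemma logRemainder_le {x : ℝ} (hx : 0 ≤ x) : logRemainder x ≤ x ^ 3 / 3 := by
  have hd : ∀ x : ℝ, 0 ≤ x → HasDerivAt (fun x => x ^ 3 / 3 - logRemainder x)
      (x ^ 2 - x ^ 2 / (1 + x)) x := fun x hx => by
    refine (((hasDerivAt_pow 3 x).div_const 3).sub (hasDerivAt_logRemainder hx)).congr_deriv ?_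
    push_cast; ring
  have hm : MonotoneOn (fun x => x ^ 3 / 3 - logRemainder x) (Ici 0) := by
    refine monotoneOn_of_hasDerivWithinAt_nonneg (f' := fun x => x ^ 2 - x ^ 2 / (1 + x))
      (convex_Ici 0) (fun x hx => (hd x hx).continuousAt.continuousWithinAt)
      (fun x hx => (hd x (interior_subset hx)).hasDerivWithinAt) fun x hx => ?_
    have : 0 ≤ x := interior_subset hx
    rw [sub_nonneg]
    exact div_le_self (sq_nonneg x) (by linarith)
  have := hm (mem_Ici.2 le_rfl) hx hx
  simp only [logRemainder] at this ⊢
  norm_num at this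
  linarith

lemma tendsto_sq_mul_logRemainder {t : ℝ} (ht : 0 ≤ t) :
    Tendsto (fun N : ℕ => (N : ℝ) ^ 2 * logRemainder (t / N)) atTop (𝓝 0) := by
  refine squeeze_zero' (Eventually.of_forall fun N => ?_) ?_
    (tendsto_const_div_atTop_nhds_zero_nat (t ^ 3 / 3))
  · exact mul_nonneg (sq_nonneg _) (logRemainder_nonneg (by positivity))
  · filter_upwards [eventually_gt_atTop 0] with N hN
    have hN' : (0 : ℝ) < N := Nat.cast_pos.2 hN
    calc (N : ℝ) ^ 2 * logRemainder (t / N) ≤ (N : ℝ) ^ 2 * ((t / N) ^ 3 / 3) := by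
          gcongr
          exact logRemainder_le (by positivity)
      _ = _ := by field_simp

lemma barnesGFactor_pos {t : ℝ} (ht : 0 < t) (k : ℕ) : 0 < barnesGFactor t k := by
  unfold barnesGFactor; positivity

lemma log_barnesGFactor {t : ℝ} (ht : 0 < t) (k : ℕ) :
    Real.log (barnesGFactor t k) = k * Real.log (1 + t / k) + (t ^ 2 / (2 * k) - t) := by
  have : 0 < 1 + t / (k : ℝ) := by positivity
  rw [barnesGFactor, Real.log_mul (by positivity) (by positivity), Real.log_pow, Real.log_exp]

lemma summable_log_barnesGFactor {t : ℝ} (ht : 0 < t) :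
    Summable fun n : ℕ => Real.log (barnesGFactor t (n + 1)) := by
  -- The exponential in each factor removes exactly the first two Taylor terms, leaving `O(1 / n ^
  -- 2)`.
  have key : ∀ n : ℕ, Real.log (barnesGFactor t (n + 1))
      = (n + 1 : ℕ) * logRemainder (t / (n + 1 : ℕ)) := fun n => by
    rw [log_barnesGFactor ht, logRemainder]
    push_cast
    field_simp
    ring
  have hs : Summable fun n : ℕ => t ^ 3 / 3 * (1 / ((n + 1 : ℕ) : ℝ) ^ 2) :=
    ((summable_nat_add_iff 1).2 (Real.summable_one_div_nat_pow.2 one_lt_two)).mul_left _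
  refine hs.of_nonneg_of_le (fun n => ?_) (fun n => ?_)
  · rw [key]
    exact mul_nonneg (Nat.cast_nonneg _) (logRemainder_nonneg (by positivity))
  · rw [key]
    calc _ ≤ ((n + 1 : ℕ) : ℝ) * ((t / (n + 1 : ℕ)) ^ 3 / 3) := by
          gcongr
          exact logRemainder_le (by positivity)
      _ = _ := by push_cast; field_simp

lemma log_barnesG_one_add {t : ℝ} (ht : 0 < t) :
    0 < barnesG (1 + t) ∧ Real.log (barnesG (1 + t)) =
      t / 2 * Real.log (2 * Real.pi)
        - 1 / 2 * (Real.eulerMascheroniConstant * t ^ 2 + t ^ 2 + t)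
        + ∑' n : ℕ, Real.log (barnesGFactor t (n + 1)) := by
  have h := (Real.hasProd_of_hasSum_log (fun n => barnesGFactor_pos ht (n + 1))
    (summable_log_barnesGFactor ht).hasSum).tprod_eq
  have hpi : 0 < 2 * Real.pi := by positivity
  have hp : 0 < (2 * Real.pi) ^ (t / 2) := Real.rpow_pos_of_pos hpi _
  simp only [barnesG, add_sub_cancel_left, h]
  refine ⟨by positivity, ?_⟩
  rw [Real.log_mul (by positivity) (by positivity), Real.log_mul (by positivity) (by positivity),
    Real.log_exp, Real.log_exp, Real.log_rpow hpi]
  ring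

/-- The elementary expression obtained by truncating the product, Euler's limit for
`log (Gamma t)` and the telescoped integral at the same index. -/
lemma truncated_sum_eq {t : ℝ} (ht : 0 < t) {N : ℕ} (hN : N ≠ 0) :
    t / 2 * Real.log (2 * Real.pi)
        - 1 / 2 * (Real.eulerMascheroniConstant * t ^ 2 + t ^ 2 + t)
        + ∑ n ∈ Finset.range N, Real.log (barnesGFactor t (n + 1))
      - t * Real.BohrMollerup.logGammaSeq t N
      - ((∫ v in Ioi 0, binetIntegrand (1 + N) 1 v) - ∫ v in Ioi 0, binetIntegrand (t + N) t v)
      = (t ^ 2 - 1) / 4 - 1 / 2 * t * (t - 1) * Real.log t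
        + t ^ 2 / 2 * (harmonic N - Real.log N - Real.eulerMascheroniConstant)
        - t * (Real.log (Stirling.stirlingSeq N) - Real.log √Real.pi)
        + 1 / 2 * (1 + (2 * t + 1) * (1 / N) + t * (t + 1) * (1 / N) ^ 2)
          * (N ^ 2 * logRemainder (t / N))
        - 1 / 2 * (1 + 1 / N) * (N ^ 2 * logRemainder (1 / N))
        + (t ^ 2 + 1) / 4 * (1 / N) - t ^ 3 * (t + 1) / 4 * (1 / N) ^ 2 := by
  have hN' : (0 : ℝ) < N := Nat.cast_pos.2 (Nat.pos_of_ne_zero hN)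
  have hG : ∑ n ∈ Finset.range N, Real.log (barnesGFactor t (n + 1))
      = (∑ n ∈ Finset.range N, (t + (n + 1)) * Real.log (t + (n + 1)))
        - t * (∑ n ∈ Finset.range N, Real.log (t + (n + 1)))
        - (∑ n ∈ Finset.range N, (n + 1 : ℝ) * Real.log (n + 1))
        + t ^ 2 / 2 * harmonic N - N * t := by
    have hc : (N : ℝ) * t = ∑ _n ∈ Finset.range N, t := by simp
    rw [hc, harmonic]
    push_cast
    simp only [Finset.mul_sum, ← Finset.sum_sub_distrib, ← Finset.sum_add_distrib]
    refine Finset.sum_congr rfl fun n _ => ?_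
    have hn : (0 : ℝ) < n + 1 := by positivity
    have hl : 1 + t / ((n : ℝ) + 1) = (t + (n + 1)) / (n + 1) := by field_simp; ring
    rw [log_barnesGFactor ht]
    push_cast
    rw [hl, Real.log_div (by positivity) hn.ne']
    field_simp
    ring
  have hΓ : ∑ m ∈ Finset.range (N + 1), Real.log (t + m)
      = Real.log t + ∑ n ∈ Finset.range N, Real.log (t + (n + 1)) := by
    rw [Finset.sum_range_succ', add_comm]; simp
  -- Reindexed so that the sum in `I(1+N, 1)` cancels the `k log k` sum of `hG`.
  have hK : ∑ n ∈ Finset.range N, (1 + ((n : ℝ) + 1)) * Real.log (1 + (n + 1))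
      = (∑ n ∈ Finset.range N, (n + 1 : ℝ) * Real.log (n + 1)) + (1 + N) * Real.log (1 + N) := by
    have h := Finset.sum_range_succ' (fun n : ℕ => (n + 1 : ℝ) * Real.log (n + 1)) N
    rw [Finset.sum_range_succ] at h
    simp only [Nat.cast_add, Nat.cast_one, Nat.cast_zero, zero_add, Real.log_one, mul_zero,
      add_zero] at h
    simp only [add_comm (1 : ℝ)]
    exact h.symm
  -- Second order is needed because these logarithms carry weights quadratic in `N`.
  have hlog : ∀ a : ℝ, 0 < a → Real.log (a + N)
      = Real.log N + logRemainder (a / N) + a / N - (a / N) ^ 2 / 2 := fun a ha => by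
    have : 1 + a / (N : ℝ) = (a + N) / N := by field_simp; ring
    rw [logRemainder, this, Real.log_div (by positivity) hN'.ne']
    ring
  have hsπ : Real.log √Real.pi = Real.log Real.pi / 2 := Real.log_sqrt Real.pi_pos.le
  rw [Real.BohrMollerup.logGammaSeq, hG, hΓ, integral_binetIntegrand_add_nat one_pos,
    integral_binetIntegrand_add_nat ht, hK, hlog t ht, hlog 1 one_pos,
    Stirling.log_stirlingSeq_formula, hsπ, Real.log_mul two_ne_zero Real.pi_ne_zero,
    Real.log_mul two_ne_zero hN'.ne', Real.log_div hN'.ne' (Real.exp_ne_zero _), Real.log_exp,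
    Real.log_one]
  field_simp
  ring

theorem log_barnesG_eq {t : ℝ} (ht : 0 < t) :
    Real.log (barnesG (1 + t)) =
      t * Real.log (Real.Gamma t) + (t ^ 2 - 1) / 4 - 1 / 2 * t * (t - 1) * Real.log t
        + ∫ v in Ioi (0 : ℝ), binetIntegrand t 1 v := by
  have h1 : Tendsto (fun N : ℕ => (1 : ℝ) / N) atTop (𝓝 0) := tendsto_one_div_atTop_nhds_zero_nat
  have hS := (Stirling.tendsto_stirlingSeq_sqrt_pi.log
    (Real.sqrt_pos.2 Real.pi_pos).ne').sub_const (Real.log √Real.pi)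
  have hH := Real.tendsto_harmonic_sub_log.sub_const Real.eulerMascheroniConstant
  have hL := ((((summable_log_barnesGFactor ht).hasSum.tendsto_sum_nat.const_add
    (t / 2 * Real.log (2 * Real.pi)
        - 1 / 2 * (Real.eulerMascheroniConstant * t ^ 2 + t ^ 2 + t))).sub
    ((Real.BohrMollerup.tendsto_log_gamma ht).const_mul t))).sub (tendsto_binet_partial ht)
  have hR := (((((hH.const_mul (t ^ 2 / 2)).const_add
      ((t ^ 2 - 1) / 4 - 1 / 2 * t * (t - 1) * Real.log t)).sub (hS.const_mul t)).add
    (((((h1.const_mul (2 * t + 1)).const_add 1).add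
      ((h1.pow 2).const_mul (t * (t + 1)))).const_mul (1 / 2)).mul
      (tendsto_sq_mul_logRemainder ht.le))).sub
    (((h1.const_add 1).const_mul (1 / 2)).mul (tendsto_sq_mul_logRemainder zero_le_one))).add
    (h1.const_mul ((t ^ 2 + 1) / 4)) |>.sub ((h1.pow 2).const_mul (t ^ 3 * (t + 1) / 4))
  have h := tendsto_nhds_unique_of_eventuallyEq hL hR (by
    filter_upwards [eventually_ne_atTop 0] with N hN
    exact truncated_sum_eq ht hN)
  rw [← (log_barnesG_one_add ht).2] at h
  linear_combination h

theorem mainTheorem7 (t : ℝ) (ht : 0 < t) :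
    Multipliable (fun n : ℕ => barnesGFactor t (n + 1)) ∧
    0 < barnesG (1 + t) ∧
    MeasureTheory.IntegrableOn
      (fun v : ℝ => (Real.exp (-t * v) - Real.exp (-v)) / v ^ 2
        * (1 / (Real.exp v - 1) - 1 / v + 1 / 2)) (Set.Ioi 0) ∧
    Real.log (barnesG (1 + t)) =
      t * Real.log (Real.Gamma t) + (t ^ 2 - 1) / 4 - 1 / 2 * t * (t - 1) * Real.log t
        + ∫ v in Set.Ioi (0 : ℝ), (Real.exp (-t * v) - Real.exp (-v)) / v ^ 2
            * (1 / (Real.exp v - 1) - 1 / v + 1 / 2) := by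
  have hf : (fun v : ℝ => (Real.exp (-t * v) - Real.exp (-v)) / v ^ 2
      * (1 / (Real.exp v - 1) - 1 / v + 1 / 2)) = binetIntegrand t 1 := by
    ext v; simp [binetIntegrand, binetKernel]
  rw [hf]
  exact ⟨Real.multipliable_of_summable_log (fun n => barnesGFactor_pos ht (n + 1))
    (summable_log_barnesGFactor ht), (log_barnesG_one_add ht).1,
    integrableOn_binetIntegrand ht one_pos, log_barnesG_eq ht⟩
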